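/- **Setting.** Kinds are generated by $\kappa ::= o \mid (\kappa_1\to\kappa_2)$. A word-generating scheme $G$ has finite sets of kinded non-terminals $N$ and terminals $T\uplus\{\$\}$, with $\$ : o$ and $a : o\to o$ for each $a\in T$, an initial symbol $S\in N$ of kind $o$, and for each non-terminal $F:\kappa_1\to\dots\to\kappa_n\to o$ a finite, non-empty list of rules $F=\lambda x_1\dots\lambda x_n.\,e_i$ $(1\le i\le \ell_F)$, where $e_i$ is a $\lambda$-free term of kind $o$ over $N$, $T\uplus\{\$\}$ and $x_1:\kappa_1,\dots,x_n:\kappa_n$. A higher-order game $\mathcal G=(G,A,O)$ consists of such a scheme, an NFA $A$ with finite state set $Q$, alphabet $T$, a single initial state $q_0$ and final states $Q_f$, and an owner $O(F)\in\{\exists,\forall\}$ for each $F\in N$. A play starts in the term $S$. In a term $a_1(\cdots(a_k(F\,t_1\cdots t_n)))$ the owner of $F$ chooses a rule $F=\lambda x_1\dots\lambda x_n.\,e$ and the play moves to $a_1(\cdots(a_k\,e[x_1\mapsto t_1,\dots,x_n\mapsto t_n]))$. Player $\exists$ wins all infinite plays, and wins a play that ends in $a_1(\cdots(a_k\,\$))$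 iff $a_1\cdots a_k\in L(A)$. Player $\exists$ wins $\mathcal G$ if she has a winning strategy. **Determinization.** The scheme $G^{\det}$ has an additional terminal $op_F : o\to\dots\to o$ of arity $\ell_F$ for each $F\in N$, and exactly one rule $F=\lambda x_1\dots\lambda x_n.\,op_F\,e_1\cdots e_{\ell_F}$ for each $F$. **Semantics.** A model consists of a ground domain $D_o$, which is a partial order with a greatest element and meets of descending $\omega$-chains, and an interpretation of each terminal of kind $\kappa$ by an element of $D_\kappa$. Here $D_{\kappa_1\to\kappa_2}$ is the set of functions $D_{\kappa_1}\to D_{\kappa_2}$ that preserve meets of descending $\omega$-chains, ordered component-wise. Terms are evaluated under valuations as usual. The semantics of a deterministic scheme is the greatest fixed point $\sigma=\bigsqcap_{i\in\mathbb N} rhs^i(\top)$ of the function $rhs$ that maps a valuation $\nu$ of the non-terminals to the valuation that assigns to each $F$ the value under $\nu$ of the right-hand side of its rule. **The optimized model.** For a word $w\in T^*$ let $\mathrm{acc}(w)\subseteq Q$ be the set of states from which $A$ accepts $w$. The ground domain consists of the formulas over the atomic propositions $Q$, up to logical equivalence and ordered by implication, that are obtained from a positive Boolean formula (built from true and atomic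 propositions by $\wedge,\vee$) over the atomic propositions $\{\mathrm{acc}(w) : w\in T^*\}$ by replacing each atomic proposition $R\subseteq Q$ by the disjunction $\bigvee_{q\in R} q$ (the empty disjunction is false). The terminal $\$$ is interpreted as $\bigvee_{q\in Q_f} q$. A letter $a$ is interpreted as the function that replaces each state $q$ in a formula by $\bigvee\{q' : q'\xrightarrow{a} q\}$, distributing over $\wedge$ and $\vee$. The terminal $op_F$ is interpreted as $\ell_F$-ary disjunction if $O(F)=\exists$ and as $\ell_F$-ary conjunction if $O(F)=\forall$. **Theorem.** Let $\sigma$ be the semantics of $G^{\det}$ in the optimized model. Then the formula $\sigma(S)$ is satisfied by the assignment $\{q_0\}$ (only $q_0$ is true) if and only if Player $\exists$ wins $\mathcal G$. -/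

import Mathlib

noncomputable section

namespace HORS

universe u v w

/-! ### Kinds and terms -/

/-- Kinds: the ground kind and function kinds. -/
inductive Kind : Type
  | ground : Kind
  | arrow : Kind → Kind → Kind

/-- The kind `ground → ⋯ → ground` with `n` arguments. -/
def Kind.power : ℕ → Kind
  | 0 => .ground
  | n + 1 => .arrow .ground (Kind.power n)

/-- `κ.binders Γ` extends the list `Γ` of kinds of variables in scope by `x₁ : κ₁, …, xₙ : κₙ`,
where `κ = κ₁ → ⋯ → κₙ → ground`. -/
def Kind.binders : Kind → List Kind → List Kind
  | .ground, Γ => Γ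
  | .arrow κ₁ κ₂, Γ => κ₂.binders (κ₁ :: Γ)

/-- `Var Γ κ`: the variables of kind `κ` in the scope `Γ`. Variables are named by their
position in the scope, that is, terms are taken up to renaming of bound variables. -/
inductive Var : List Kind → Kind → Type
  | zero {Γ : List Kind} {κ : Kind} : Var (κ :: Γ) κ
  | succ {Γ : List Kind} {κ κ' : Kind} : Var Γ κ → Var (κ' :: Γ) κ

/-- There are no variables in the empty scope. -/
def Var.elim {α : Sort u} {κ : Kind} (x : Var [] κ) : α := nomatch x

/-- `Term τ η Γ κ`: the terms of kind `κ` over terminals (kinded by `τ`), non-terminals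
(kinded by `η`), and the variables in the scope `Γ`. -/
inductive Term {T : Type u} {N : Type v} (τ : T → Kind) (η : N → Kind) :
    List Kind → Kind → Type (max u v)
  | terminal {Γ : List Kind} (s : T) : Term τ η Γ (τ s)
  | nonterminal {Γ : List Kind} (F : N) : Term τ η Γ (η F)
  | var {Γ : List Kind} {κ : Kind} (x : Var Γ κ) : Term τ η Γ κ
  | app {Γ : List Kind} {κ₁ κ₂ : Kind} (t : Term τ η Γ (.arrow κ₁ κ₂)) (t' : Term τ η Γ κ₁) :
      Term τ η Γ κ₂
  | lam {Γ : List Kind} {κ₁ κ₂ : Kind} (t : Term τ η (κ₁ :: Γ) κ₂) : Term τ η Γ (.arrow κ₁ κ₂)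

namespace Term

variable {T : Type u} {N : Type v} {τ : T → Kind} {η : N → Kind}

/-- The term contains no sub-term of the form `λ x. t`. -/
def LambdaFree : {Γ : List Kind} → {κ : Kind} → Term τ η Γ κ → Prop
  | _, _, terminal _ => True
  | _, _, nonterminal _ => True
  | _, _, var _ => True
  | _, _, app t t' => t.LambdaFree ∧ t'.LambdaFree
  | _, _, lam _ => False

/-- Change the kind index along an equality of kinds. -/
def ofKind {Γ : List Kind} {κ κ' : Kind} (h : κ = κ') (t : Term τ η Γ κ) : Term τ η Γ κ' :=
  h ▸ t

/-- Extend a renaming of variables under a binder. -/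
def liftRen {Γ Δ : List Kind} {κ' : Kind} (r : ∀ κ, Var Γ κ → Var Δ κ) :
    ∀ κ, Var (κ' :: Γ) κ → Var (κ' :: Δ) κ
  | _, .zero => .zero
  | _, .succ x => .succ (r _ x)

/-- Renaming of variables. -/
def rename : {Γ Δ : List Kind} → {κ : Kind} → (∀ κ, Var Γ κ → Var Δ κ) →
    Term τ η Γ κ → Term τ η Δ κ
  | _, _, _, _, terminal s => terminal s
  | _, _, _, _, nonterminal F => nonterminal F
  | _, _, _, r, var x => var (r _ x)
  | _, _, _, r, app t t' => app (t.rename r) (t'.rename r)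
  | _, _, _, r, lam t => lam (t.rename (liftRen r))

/-- Extend a substitution under a binder. -/
def liftSub {Γ Δ : List Kind} {κ' : Kind} (σ : ∀ κ, Var Γ κ → Term τ η Δ κ) :
    ∀ κ, Var (κ' :: Γ) κ → Term τ η (κ' :: Δ) κ
  | _, .zero => var .zero
  | _, .succ x => (σ _ x).rename (fun _ => Var.succ)

/-- Simultaneous capture-avoiding substitution. -/
def subst : {Γ Δ : List Kind} → {κ : Kind} → (∀ κ, Var Γ κ → Term τ η Δ κ) →
    Term τ η Γ κ → Term τ η Δ κ
  | _, _, _, _, terminal s => terminal s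
  | _, _, _, _, nonterminal F => nonterminal F
  | _, _, _, σ, var x => σ _ x
  | _, _, _, σ, app t t' => app (t.subst σ) (t'.subst σ)
  | _, _, _, σ, lam t => lam (t.subst (liftSub σ))

/-- `lams κ e` is `λ x₁. ⋯ λ xₙ. e`, where `κ = κ₁ → ⋯ → κₙ → ground`. -/
def lams : (κ : Kind) → {Γ : List Kind} → Term τ η (κ.binders Γ) .ground → Term τ η Γ κ
  | .ground, _, e => e
  | .arrow _ κ₂, _, e => lam (lams κ₂ e)

/-- `applyPower n t e` is `t e₁ ⋯ eₙ` for `t : ground → ⋯ → ground`. -/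
def applyPower {Γ : List Kind} : (n : ℕ) → Term τ η Γ (Kind.power n) →
    (Fin n → Term τ η Γ .ground) → Term τ η Γ .ground
  | 0, t, _ => t
  | n + 1, t, e => applyPower n (app t (e 0)) (fun i => e i.succ)

/-- View a term over the terminals `T` as a term over the terminals `T ⊕ T'`. -/
def addTerminals {T' : Type w} {τ' : T' → Kind} : {Γ : List Kind} → {κ : Kind} →
    Term τ η Γ κ → Term (Sum.elim τ τ') η Γ κ
  | _, _, terminal s => terminal (τ := Sum.elim τ τ') (Sum.inl s)
  | _, _, nonterminal F => nonterminal F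
  | _, _, var x => var x
  | _, _, app t t' => app t.addTerminals t'.addTerminals
  | _, _, lam t => lam t.addTerminals

/-- Tuples of closed terms `t₁ : κ₁, …, tₙ : κₙ`, where `κ = κ₁ → ⋯ → κₙ → ground`. -/
def Args (τ : T → Kind) (η : N → Kind) : Kind → Type (max u v)
  | .ground => PUnit
  | .arrow κ₁ κ₂ => Term τ η [] κ₁ × Args τ η κ₂

/-- `applyArgs κ t (t₁, …, tₙ)` is `t t₁ ⋯ tₙ`. -/
def applyArgs : (κ : Kind) → Term τ η [] κ → Args τ η κ → Term τ η [] .ground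
  | .ground, t, _ => t
  | .arrow _ κ₂, t, ts => applyArgs κ₂ (app t ts.1) ts.2

/-- Extend a substitution by one closed term. -/
def consSub {Γ : List Kind} {κ' : Kind} (t : Term τ η [] κ')
    (σ : ∀ κ, Var Γ κ → Term τ η [] κ) : ∀ κ, Var (κ' :: Γ) κ → Term τ η [] κ
  | _, .zero => t
  | _, .succ x => σ _ x

/-- The substitution `[x₁ ↦ t₁, …, xₙ ↦ tₙ]`, extending `σ`. -/
def argSub : (κ : Kind) → {Γ : List Kind} → Args τ η κ → (∀ κ, Var Γ κ → Term τ η [] κ) →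
    ∀ κ', Var (κ.binders Γ) κ' → Term τ η [] κ'
  | .ground, _, _, σ => σ
  | .arrow _ κ₂, _, ts, σ => argSub κ₂ ts.2 (consSub ts.1 σ)

/-- `instantiate κ e (t₁, …, tₙ)` is `e[x₁ ↦ t₁, …, xₙ ↦ tₙ]`. -/
def instantiate (κ : Kind) (e : Term τ η (κ.binders []) .ground) (ts : Args τ η κ) :
    Term τ η [] .ground :=
  e.subst (argSub κ ts (fun _ x => x.elim))

end Term

/-! ### Schemes and determinization -/

/-- A higher-order recursion scheme with terminals kinded by `τ` and non-terminals kinded by `η`.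
The rules of `F : κ₁ → ⋯ → κₙ → ground` are `F = λ x₁. ⋯ λ xₙ. body F i`, `i < ruleCount F`. -/
structure Scheme {T : Type u} {N : Type v} (τ : T → Kind) (η : N → Kind) where
  start : N
  start_kind : η start = .ground
  ruleCount : N → ℕ
  ruleCount_pos : ∀ F, 0 < ruleCount F
  body : ∀ F, Fin (ruleCount F) → Term τ η ((η F).binders []) .ground
  body_lambdaFree : ∀ F i, (body F i).LambdaFree

namespace Scheme

variable {T : Type u} {N : Type v} {τ : T → Kind} {η : N → Kind}

/-- There is exactly one rule for each non-terminal. -/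
def Deterministic (G : Scheme τ η) : Prop := ∀ F, G.ruleCount F = 1

/-- The initial symbol as a closed term of ground kind. -/
def startTerm (G : Scheme τ η) : Term τ η [] .ground :=
  Term.ofKind G.start_kind (.nonterminal G.start)

/-- The right-hand side `λ x₁. ⋯ λ xₙ. e` of the only rule of `F` in a deterministic scheme. -/
def rhs (G : Scheme τ η) (hG : G.Deterministic) (F : N) : Term τ η [] (η F) :=
  Term.lams (η F) (G.body F ⟨0, by rw [hG F]; exact Nat.one_pos⟩)

/-- The kinds of the terminals of the determinized scheme: those of the original terminals,
and a terminal `op F : ground → ⋯ → ground` for each non-terminal `F`, whose arity is the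
number of rules of `F`. -/
abbrev detKind (G : Scheme τ η) : T ⊕ N → Kind :=
  Sum.elim τ (fun F => Kind.power (G.ruleCount F))

theorem applyPower_lambdaFree {Γ : List Kind} : (n : ℕ) → (t : Term τ η Γ (Kind.power n)) →
    (e : Fin n → Term τ η Γ .ground) → t.LambdaFree → (∀ i, (e i).LambdaFree) →
    (Term.applyPower n t e).LambdaFree
  | 0, _, _, ht, _ => ht
  | n + 1, t, e, ht, he =>
    applyPower_lambdaFree n (.app t (e 0)) _ ⟨ht, he 0⟩ (fun i => he i.succ)

theorem addTerminals_lambdaFree {T' : Type w} {τ' : T' → Kind} {Γ : List Kind} {κ : Kind}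
    (t : Term τ η Γ κ) (ht : t.LambdaFree) :
    (t.addTerminals (τ' := τ')).LambdaFree := by
  induction t with
  | terminal s => trivial
  | nonterminal F => trivial
  | var x => trivial
  | app t t' ih ih' => exact ⟨ih ht.1, ih' ht.2⟩
  | lam t _ => exact ht.elim

/-- The determinized scheme: the only rule of `F` is
`F = λ x₁. ⋯ λ xₙ. op F e₁ ⋯ eₗ`, where `e₁, …, eₗ` are the bodies of the rules of `F` in `G`. -/
def det (G : Scheme τ η) : Scheme G.detKind η where
  start := G.start
  start_kind := G.start_kind
  ruleCount := fun _ => 1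
  ruleCount_pos := fun _ => Nat.one_pos
  body := fun F _ =>
    Term.applyPower (G.ruleCount F) (Term.terminal (τ := G.detKind) (Sum.inr F))
      (fun i => (G.body F i).addTerminals)
  body_lambdaFree := fun F _ =>
    applyPower_lambdaFree _ _ _ trivial
      (fun i => addTerminals_lambdaFree _ (G.body_lambdaFree F i))

theorem det_deterministic (G : Scheme τ η) : G.det.Deterministic := fun _ => rfl

end Scheme

/-! ### Domains -/

/-- A pointed `ω`-complete partial order: there is a greatest element, and
each descending chain has a greatest lower bound. -/
structure Cppo where
  carrier : Type u
  [partialOrder : PartialOrder carrier]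
  [orderTop : OrderTop carrier]
  exists_meet : ∀ d : ℕ → carrier, Antitone d → ∃ m, IsGLB (Set.range d) m

instance : CoeSort Cppo.{u} (Type u) := ⟨Cppo.carrier⟩

attribute [instance] Cppo.partialOrder Cppo.orderTop

/-- The greatest lower bound of a descending chain. -/
def Cppo.meet (D : Cppo.{u}) (d : ℕ → D) (hd : Antitone d) : D := (D.exists_meet d hd).choose

/-- `f` preserves greatest lower bounds of descending chains. -/
def MeetContinuous {α : Type u} {β : Type v} [PartialOrder α] [PartialOrder β] (f : α → β) :
    Prop :=
  ∀ d : ℕ → α, Antitone d → ∀ m, IsGLB (Set.range d) m →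
    IsGLB (Set.range (fun i => f (d i))) (f m)

theorem MeetContinuous.monotone {α : Type u} {β : Type v} [PartialOrder α] [PartialOrder β]
    {f : α → β} (hf : MeetContinuous f) : Monotone f := by
  intro x y hxy
  have hd : Antitone (fun n : ℕ => if n = 0 then y else x) := by
    intro m n hmn
    dsimp only
    split_ifs with h1 h2
    · exact le_rfl
    · omega
    · exact hxy
    · exact le_rfl
  have hm : IsGLB (Set.range (fun n : ℕ => if n = 0 then y else x)) x := by
    constructor
    · rintro _ ⟨n, rfl⟩
      dsimp only
      split_ifs
      · exact hxy
      · exact le_rfl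
    · intro z hz
      exact hz ⟨1, by simp⟩
  exact (hf _ hd _ hm).1 ⟨0, by simp⟩

/-- The `⊓`-continuous functions. -/
structure ContFun (α : Type u) (β : Type v) [PartialOrder α] [PartialOrder β] where
  toFun : α → β
  cont : MeetContinuous toFun

instance {α : Type u} {β : Type v} [PartialOrder α] [PartialOrder β] :
    CoeFun (ContFun α β) (fun _ => α → β) := ⟨ContFun.toFun⟩

/-- Functions are ordered component-wise. -/
instance {α : Type u} {β : Type v} [PartialOrder α] [PartialOrder β] :
    PartialOrder (ContFun α β) where
  le f g := ∀ x, f x ≤ g x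
  le_refl _ _ := le_rfl
  le_trans _ _ _ h h' x := (h x).trans (h' x)
  le_antisymm f g h h' := by
    obtain ⟨f, _⟩ := f
    obtain ⟨g, _⟩ := g
    have : f = g := funext fun x => le_antisymm (h x) (h' x)
    subst this
    rfl

instance {α : Type u} {β : Type v} [PartialOrder α] [PartialOrder β] [OrderTop β] :
    OrderTop (ContFun α β) where
  top := ⟨fun _ => ⊤, fun _ _ _ _ =>
    ⟨by rintro _ ⟨_, rfl⟩; exact le_rfl, fun _ hz => hz ⟨0, rfl⟩⟩⟩
  le_top _ _ := le_top

theorem ContFun.exists_pointwise_meet {α : Type u} [PartialOrder α] (D : Cppo.{v})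
    (d : ℕ → ContFun α D) (hd : Antitone d) :
    ∃ m : ContFun α D, ∀ x, IsGLB (Set.range fun i => d i x) (m x) := by
  have hx : ∀ x, ∃ m, IsGLB (Set.range fun i => d i x) m := fun x =>
    D.exists_meet _ (fun _ _ hij => hd hij x)
  choose m hm using hx
  refine ⟨⟨m, fun c hc l hl => ⟨?_, fun z hz => ?_⟩⟩, hm⟩
  · rintro _ ⟨j, rfl⟩
    refine (hm (c j)).2 ?_
    rintro _ ⟨i, rfl⟩
    exact ((hm l).1 ⟨i, rfl⟩).trans ((d i).cont.monotone (hl.1 ⟨j, rfl⟩))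
  · refine (hm l).2 ?_
    rintro _ ⟨i, rfl⟩
    refine ((d i).cont c hc l hl).2 ?_
    rintro _ ⟨j, rfl⟩
    exact (hz ⟨j, rfl⟩).trans ((hm (c j)).1 ⟨i, rfl⟩)

theorem ContFun.isGLB_apply {α : Type u} [PartialOrder α] {D : Cppo.{v}}
    {d : ℕ → ContFun α D} (hd : Antitone d) {f : ContFun α D} (hf : IsGLB (Set.range d) f)
    (x : α) : IsGLB (Set.range fun i => d i x) (f x) := by
  obtain ⟨m, hm⟩ := ContFun.exists_pointwise_meet D d hd
  have h : IsGLB (Set.range d) m :=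
    ⟨by rintro _ ⟨i, rfl⟩ y; exact (hm y).1 ⟨i, rfl⟩,
      fun g hg y => (hm y).2 (by rintro _ ⟨i, rfl⟩; exact hg ⟨i, rfl⟩ y)⟩
  rw [hf.unique h]
  exact hm x

theorem ContFun.isGLB_of_apply {α : Type u} {β : Type v} [PartialOrder α] [PartialOrder β]
    {d : ℕ → ContFun α β} {f : ContFun α β}
    (h : ∀ x, IsGLB (Set.range fun i => d i x) (f x)) : IsGLB (Set.range d) f :=
  ⟨by rintro _ ⟨i, rfl⟩ y; exact (h y).1 ⟨i, rfl⟩,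
    fun g hg y => (h y).2 (by rintro _ ⟨i, rfl⟩; exact hg ⟨i, rfl⟩ y)⟩

/-- The cppo of `⊓`-continuous functions between two cppos. -/
def Cppo.fun (D : Cppo.{u}) (E : Cppo.{v}) : Cppo.{max u v} where
  carrier := ContFun D E
  exists_meet d hd := by
    obtain ⟨m, hm⟩ := ContFun.exists_pointwise_meet E d hd
    exact ⟨m, ContFun.isGLB_of_apply hm⟩

/-- The domain of each kind, over the ground domain `D`. -/
def Cppo.dom (D : Cppo.{u}) : Kind → Cppo.{u}
  | .ground => D
  | .arrow κ₁ κ₂ => (D.dom κ₁).fun (D.dom κ₂)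

/-! ### Semantics of deterministic schemes in a model -/

/-- A model for terminals kinded by `τ`: a ground domain and an interpretation of the terminals. -/
structure Model {T : Type u} (τ : T → Kind) where
  domain : Cppo.{w}
  interp : ∀ s, domain.dom (τ s)

/-- Valuations of the non-terminals and of the variables in the scope `Γ`. -/
abbrev Valuation (D : Cppo.{w}) {N : Type v} (η : N → Kind) (Γ : List Kind) : Type (max v w) :=
  (∀ F, D.dom (η F)) × (∀ κ, Var Γ κ → D.dom κ)

/-- The valuation `ν[x ↦ d]`, for a new variable `x`. -/
def extendVar {D : Cppo.{w}} {Γ : List Kind} {κ' : Kind} (ρ : ∀ κ, Var Γ κ → D.dom κ)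
    (d : D.dom κ') : ∀ κ, Var (κ' :: Γ) κ → D.dom κ
  | _, .zero => d
  | _, .succ x => ρ _ x

theorem isGLB_extendVar {D : Cppo.{w}} {Γ : List Kind} {κ' : Kind}
    {r : ℕ → ∀ κ, Var Γ κ → D.dom κ} {ρ : ∀ κ, Var Γ κ → D.dom κ}
    {c : ℕ → D.dom κ'} {d : D.dom κ'}
    (hr : ∀ κ x, IsGLB (Set.range fun i => r i κ x) (ρ κ x)) (hc : IsGLB (Set.range c) d) :
    ∀ κ x, IsGLB (Set.range fun i => extendVar (r i) (c i) κ x) (extendVar ρ d κ x)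
  | _, .zero => hc
  | _, .succ x => hr _ x

theorem Valuation.isGLB_iff {D : Cppo.{w}} {N : Type v} {η : N → Kind} {Γ : List Kind}
    {d : ℕ → Valuation D η Γ} {m : Valuation D η Γ} :
    IsGLB (Set.range d) m ↔ (∀ F, IsGLB (Set.range fun i => (d i).1 F) (m.1 F)) ∧
      ∀ κ x, IsGLB (Set.range fun i => (d i).2 κ x) (m.2 κ x) := by
  simp only [isGLB_prod, isGLB_pi, ← Set.range_comp]
  rfl

theorem isGLB_const {α : Type u} [PartialOrder α] (a : α) : IsGLB (Set.range fun _ : ℕ => a) a :=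
  ⟨by rintro _ ⟨_, rfl⟩; exact le_rfl, fun _ hz => hz ⟨0, rfl⟩⟩

theorem MeetContinuous.extend {D : Cppo.{w}} {N : Type v} {η : N → Kind} {Γ : List Kind}
    {κ₁ κ₂ : Kind} (f : ContFun (Valuation D η (κ₁ :: Γ)) (D.dom κ₂))
    {e : ℕ → Valuation D η Γ} (he : Antitone e) {m : Valuation D η Γ} (hm : IsGLB (Set.range e) m)
    {c : ℕ → D.dom κ₁} (hc : Antitone c) {l : D.dom κ₁} (hl : IsGLB (Set.range c) l) :
    IsGLB (Set.range fun i => f ((e i).1, extendVar (e i).2 (c i))) (f (m.1, extendVar m.2 l)) := by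
  rw [Valuation.isGLB_iff] at hm
  refine f.cont (fun i => ((e i).1, extendVar (e i).2 (c i))) ?_ _
    (Valuation.isGLB_iff.2 ⟨hm.1, isGLB_extendVar hm.2 hl⟩)
  intro i j hij
  refine ⟨(he hij).1, fun κ x => ?_⟩
  cases x with
  | zero => exact hc hij
  | succ x => exact (he hij).2 κ x

/-- The semantics of terms in a model. It is `⊓`-continuous in the valuation. -/
def Model.sem {T : Type u} {N : Type v} {τ : T → Kind} {η : N → Kind} (M : Model.{u, w} τ) :
    {Γ : List Kind} → {κ : Kind} → Term τ η Γ κ →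
      ContFun (Valuation M.domain η Γ) (M.domain.dom κ)
  | _, _, .terminal s => ⟨fun _ => M.interp s, fun _ _ _ _ => isGLB_const _⟩
  | _, _, .nonterminal F => ⟨fun ν => ν.1 F, fun _ _ _ hm => (Valuation.isGLB_iff.1 hm).1 F⟩
  | _, _, .var x => ⟨fun ν => ν.2 _ x, fun _ _ _ hm => (Valuation.isGLB_iff.1 hm).2 _ x⟩
  | _, _, .app (κ₁ := κ₁) (κ₂ := κ₂) t t' =>
    ⟨fun ν => ContFun.toFun (α := M.domain.dom κ₁) (β := M.domain.dom κ₂) (M.sem t ν) (M.sem t' ν),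
      by
        intro d hd m hm
        have h1 := (M.sem t).cont d hd m hm
        have h2 := (M.sem t').cont d hd m hm
        have a1 : Antitone fun i => M.sem t (d i) := fun _ _ h => (M.sem t).cont.monotone (hd h)
        have a2 : Antitone fun i => M.sem t' (d i) := fun _ _ h => (M.sem t').cont.monotone (hd h)
        have h3 := fun x => ContFun.isGLB_apply (D := M.domain.dom κ₂) a1 h1 x
        refine ⟨?_, fun z hz => ?_⟩
        · rintro _ ⟨i, rfl⟩
          exact ((h3 _).1 ⟨i, rfl⟩).trans
            ((ContFun.cont (α := M.domain.dom κ₁) (β := M.domain.dom κ₂)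
              (M.sem t (d i))).monotone (h2.1 ⟨i, rfl⟩))
        · refine (h3 _).2 ?_
          rintro _ ⟨i, rfl⟩
          refine (ContFun.cont (α := M.domain.dom κ₁) (β := M.domain.dom κ₂)
            (M.sem t (d i)) _ a2 _ h2).2 ?_
          rintro _ ⟨j, rfl⟩
          refine (hz ⟨max i j, rfl⟩).trans ?_
          exact (a1 (le_max_left i j) _).trans
            ((ContFun.cont (α := M.domain.dom κ₁) (β := M.domain.dom κ₂)
              (M.sem t (d i))).monotone (a2 (le_max_right i j)))⟩
  | _, _, .lam (κ₁ := κ₁) (κ₂ := κ₂) t =>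
    ⟨fun ν => (⟨fun d => M.sem t (ν.1, extendVar ν.2 d), fun _ hc _ hl =>
        MeetContinuous.extend (M.sem t) (e := fun _ => ν) (fun _ _ _ => le_rfl)
          (isGLB_const ν) hc hl⟩ : ContFun (M.domain.dom κ₁) (M.domain.dom κ₂)),
      fun _ hd _ hm => ContFun.isGLB_of_apply (α := M.domain.dom κ₁) (β := M.domain.dom κ₂)
        fun _ => MeetContinuous.extend (M.sem t) hd hm (fun _ _ _ => le_rfl) (isGLB_const _)⟩

namespace Model

variable {T : Type u} {N : Type v} {τ : T → Kind} {η : N → Kind}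

/-- The function on valuations of the non-terminals that evaluates the right-hand sides. -/
def rhsFun (M : Model.{u, w} τ) (G : Scheme τ η) (hG : G.Deterministic)
    (ν : ∀ F, M.domain.dom (η F)) : ∀ F, M.domain.dom (η F) :=
  fun F => M.sem (G.rhs hG F) (ν, fun _ x => x.elim)

theorem rhsFun_monotone (M : Model.{u, w} τ) (G : Scheme τ η) (hG : G.Deterministic) :
    Monotone (M.rhsFun G hG) :=
  fun _ _ h F => (M.sem (G.rhs hG F)).cont.monotone ⟨h, fun _ x => x.elim⟩

/-- The `i`-th approximant of the Kleene iteration from the greatest valuation. -/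
def approx (M : Model.{u, w} τ) (G : Scheme τ η) (hG : G.Deterministic) (i : ℕ) :
    ∀ F, M.domain.dom (η F) :=
  (M.rhsFun G hG)^[i] ⊤

theorem approx_antitone (M : Model.{u, w} τ) (G : Scheme τ η) (hG : G.Deterministic) (F : N) :
    Antitone fun i => M.approx G hG i F :=
  fun _ _ h => (M.rhsFun_monotone G hG).antitone_iterate_of_map_le le_top h F

/-- The semantics of a deterministic scheme in a model: the greatest fixed point of `rhsFun`,
as the meet of the approximants. -/
def solution (M : Model.{u, w} τ) (G : Scheme τ η) (hG : G.Deterministic) :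
    ∀ F, M.domain.dom (η F) :=
  fun F => (M.domain.dom (η F)).meet _ (M.approx_antitone G hG F)

/-- The semantics of the initial symbol, an element of the ground domain. -/
def solutionStart (M : Model.{u, w} τ) (G : Scheme τ η) (hG : G.Deterministic) : M.domain :=
  cast (congrArg (fun κ => (M.domain.dom κ : Type w)) G.start_kind) (M.solution G hG G.start)

end Model

/-! ### Higher-order games -/

/-- Terminals of a word-generating scheme: the letters and the end marker. -/
inductive WordTerminal (T : Type u) : Type u
  | letter : T → WordTerminal T
  | endMarker : WordTerminal T

/-- Letters have kind `ground → ground`, the end marker has kind `ground`. -/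
abbrev WordTerminal.kind {T : Type u} : WordTerminal T → Kind
  | .letter _ => .arrow .ground .ground
  | .endMarker => .ground

inductive Player : Type
  | existential
  | universal

/-- A higher-order game: a word-generating scheme, a non-deterministic automaton with a single
initial state, and an owner for each non-terminal. -/
structure Game (T : Type u) (N : Type v) (Q : Type w) where
  kind : N → Kind
  scheme : Scheme (WordTerminal.kind (T := T)) kind
  aut : NFA T Q
  init : Q
  start_eq : aut.start = {init}
  owner : N → Player

/-- A finite or infinite sequence of positions. -/
inductive Play (P : Type u) : Type u
  | finite : List P → Play P
  | infinite : (ℕ → P) → Play P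

namespace Game

variable {T : Type u} {N : Type v} {Q : Type w}

/-- Positions are closed terms of ground kind. -/
abbrev Position (g : Game T N Q) : Type (max u v) :=
  Term (WordTerminal.kind (T := T)) g.kind [] .ground

/-- The term `a t`. -/
def consLetter (g : Game T N Q) (a : T) (t : g.Position) : g.Position :=
  Term.app (κ₁ := .ground) (κ₂ := .ground)
    (Term.terminal (τ := WordTerminal.kind (T := T)) (.letter a)) t

/-- The term `a₁ (a₂ (⋯ (aₖ $)))`, understood as the word `a₁ ⋯ aₖ`. -/
def wordTerm (g : Game T N Q) : List T → g.Position
  | [] => Term.terminal (τ := WordTerminal.kind (T := T)) .endMarker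
  | a :: l => g.consLetter a (g.wordTerm l)

/-- `g.Move p t t'`: in `t = a₁ (⋯ (aₖ (F t₁ ⋯ tₘ)))`, player `p` owns `F` and can choose a rule
`F = λ x₁. ⋯ λ xₘ. e` such that `t' = a₁ (⋯ (aₖ e[x₁ ↦ t₁, …, xₘ ↦ tₘ]))`. -/
inductive Move (g : Game T N Q) : Player → g.Position → g.Position → Prop
  | redex (F : N) (ts : Term.Args WordTerminal.kind g.kind (g.kind F))
      (i : Fin (g.scheme.ruleCount F)) :
      Move g (g.owner F) (Term.applyArgs (g.kind F) (.nonterminal F) ts)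
        (Term.instantiate (g.kind F) (g.scheme.body F i) ts)
  | letter (a : T) {p : Player} {t t' : g.Position} (h : Move g p t t') :
      Move g p (g.consLetter a t) (g.consLetter a t')

/-- A move of the owner of the current redex. -/
def Step (g : Game T N Q) (t t' : g.Position) : Prop := ∃ p, g.Move p t t'

/-- It is the turn of player `p`. -/
def Turn (g : Game T N Q) (p : Player) (t : g.Position) : Prop := ∃ t', g.Move p t t'

/-- A finite initial part of a play. -/
def IsHistory (g : Game T N Q) (l : List g.Position) : Prop :=
  l.head? = some g.scheme.startTerm ∧ l.IsChain g.Step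

/-- The maximal plays: they start in the initial symbol, and either end in a position
without moves or are infinite. -/
def IsMaximalPlay (g : Game T N Q) : Play g.Position → Prop
  | .finite l => g.IsHistory l ∧ ∀ t ∈ l.getLast?, ∀ t', ¬ g.Step t t'
  | .infinite f => f 0 = g.scheme.startTerm ∧ ∀ n, g.Step (f n) (f (n + 1))

/-- Player `∃` wins infinite plays, and finite maximal plays that produce a word
in the language of the automaton. -/
def WonByExistential (g : Game T N Q) : Play g.Position → Prop
  | .finite l => ∃ x ∈ g.aut.accepts, l.getLast? = some (g.wordTerm x)
  | .infinite _ => True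

/-- A strategy of Player `∃` maps each history that ends in a position of Player `∃` to a
position that can be reached by a move of Player `∃`. -/
def IsStrategy (g : Game T N Q) (σ : List g.Position → g.Position) : Prop :=
  ∀ l t, g.IsHistory (l ++ [t]) → g.Turn .existential t → g.Move .existential t (σ (l ++ [t]))

/-- Player `∃` moves according to `σ` along the play. -/
def Conforms (g : Game T N Q) (σ : List g.Position → g.Position) : Play g.Position → Prop
  | .finite l => ∀ (l₁ l₂ : List g.Position) (t t' : g.Position), l = l₁ ++ t :: t' :: l₂ →
      g.Turn .existential t → t' = σ (l₁ ++ [t])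
  | .infinite f => ∀ n, g.Turn .existential (f n) →
      f (n + 1) = σ ((List.range (n + 1)).map f)

/-- Player `∃` has a winning strategy. -/
def ExistentialWins (g : Game T N Q) : Prop :=
  ∃ σ, g.IsStrategy σ ∧ ∀ π, g.IsMaximalPlay π → g.Conforms σ π → g.WonByExistential π

end Game

/-! ### Boolean formulas -/

/-- Boolean formulas without negation; `fls` is the empty disjunction. -/
inductive Formula (P : Type u) : Type u
  | tru : Formula P
  | fls : Formula P
  | atom : P → Formula P
  | and : Formula P → Formula P → Formula P
  | or : Formula P → Formula P → Formula P

namespace Formula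

variable {P : Type u} {P' : Type v}

/-- The formula is composed of `tru` and atomic propositions by conjunction and disjunction. -/
def IsPositive : Formula P → Prop
  | tru => True
  | fls => False
  | atom _ => True
  | and φ ψ => φ.IsPositive ∧ ψ.IsPositive
  | or φ ψ => φ.IsPositive ∧ ψ.IsPositive

/-- The assignment that makes exactly the elements of `X` true satisfies the formula. -/
def Sat (X : Set P) : Formula P → Prop
  | tru => True
  | fls => False
  | atom p => p ∈ X
  | and φ ψ => φ.Sat X ∧ ψ.Sat X
  | or φ ψ => φ.Sat X ∨ ψ.Sat X

/-- Replace each atomic proposition `p` by `f p`. -/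
def bind (f : P → Formula P') : Formula P → Formula P'
  | tru => tru
  | fls => fls
  | atom p => f p
  | and φ ψ => and (φ.bind f) (ψ.bind f)
  | or φ ψ => or (φ.bind f) (ψ.bind f)

/-- The disjunction `⋁ S` of the elements of a set of atomic propositions. -/
def bigOr [Finite P] (S : Set P) : Formula P :=
  (S.toFinite.toFinset.toList.map atom).foldr or fls

theorem sat_foldr_or (X : Set P) (l : List P) :
    ((l.map atom).foldr or fls).Sat X ↔ ∃ p ∈ l, p ∈ X := by
  induction l with
  | nil => simp [Sat]
  | cons a l ih => simp [Sat, ih]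

theorem sat_bigOr [Finite P] (X S : Set P) : (bigOr S).Sat X ↔ ∃ p ∈ S, p ∈ X := by
  simp [bigOr, sat_foldr_or]

theorem sat_bind (f : P → Formula P') (X : Set P') (φ : Formula P) :
    (φ.bind f).Sat X ↔ φ.Sat {p | (f p).Sat X} := by
  induction φ with
  | tru => rfl
  | fls => rfl
  | atom p => rfl
  | and φ ψ h h' => exact and_congr h h'
  | or φ ψ h h' => exact or_congr h h'

end Formula

/-! ### The optimized model -/

section Optimized

variable {T : Type u} {Q : Type w}

/-- The set of states from which the word `x` is accepted. -/
def acceptFrom (A : NFA T Q) (x : List T) : Set Q := {q | x ∈ A.acceptsFrom {q}}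

/-- The sets of states of the form `acceptFrom A x`. -/
def acceptSets (A : NFA T Q) : Set (Set Q) := Set.range (acceptFrom A)

/-- The predecessors of `S` under the letter `a`. -/
def predec (A : NFA T Q) (a : T) (S : Set Q) : Set Q := {q' | ∃ q ∈ S, q ∈ A.step q' a}

theorem predec_acceptFrom (A : NFA T Q) (a : T) (x : List T) :
    predec A a (acceptFrom A x) = acceptFrom A (a :: x) := by
  ext q
  have h : A.stepSet {q} a = A.step q a := by simp
  change (∃ q' ∈ acceptFrom A x, q' ∈ A.step q a) ↔ ∃ s ∈ A.accept, s ∈ A.evalFrom {q} (a :: x)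
  rw [NFA.evalFrom_cons, h]
  constructor
  · rintro ⟨q', ⟨s, hs, hx⟩, hq'⟩
    exact ⟨s, hs, A.mem_evalFrom_iff_exists.2 ⟨q', hq', hx⟩⟩
  · rintro ⟨s, hs, hx⟩
    obtain ⟨q', hq', hx'⟩ := A.mem_evalFrom_iff_exists.1 hx
    exact ⟨q', ⟨s, hs, hx'⟩, hq'⟩

/-- The abstraction of formulas over sets of states to formulas over states, which replaces
each `S` by `⋁ S`. -/
def optAbs [Finite Q] {𝒮 : Set (Set Q)} : Formula 𝒮 → Formula Q :=
  Formula.bind (fun S => Formula.bigOr S.1)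

/-- The formulas over states that are, up to logical equivalence, abstractions of positive
Boolean formulas over the sets `acceptFrom A x`. -/
def OptFormula [Finite Q] (A : NFA T Q) : Type w :=
  {ψ : Formula Q // ∃ φ : Formula (acceptSets A), φ.IsPositive ∧
    ∀ X, ψ.Sat X ↔ (optAbs φ).Sat X}

/-- Logical equivalence. -/
instance optSetoid [Finite Q] (A : NFA T Q) : Setoid (OptFormula A) where
  r ψ ψ' := ∀ X, ψ.1.Sat X ↔ ψ'.1.Sat X
  iseqv := ⟨fun _ _ => Iff.rfl, fun h X => (h X).symm, fun h h' X => (h X).trans (h' X)⟩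

/-- The ground domain of the optimized model: formulas up to logical equivalence. -/
def OptDomain [Finite Q] (A : NFA T Q) : Type w := Quotient (optSetoid A)

namespace OptDomain

variable [Finite Q] {A : NFA T Q}

/-- Satisfaction by the assignment `X`. -/
def Sat (X : Set Q) : OptDomain A → Prop :=
  Quotient.lift (fun ψ => ψ.1.Sat X) (fun _ _ h => propext (h X))

theorem ext_sat {x y : OptDomain A} (h : ∀ X, x.Sat X ↔ y.Sat X) : x = y := by
  induction x using Quotient.inductionOn
  induction y using Quotient.inductionOn
  exact Quotient.sound h

/-- Conjunction. -/
def and : OptDomain A → OptDomain A → OptDomain A :=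
  Quotient.map₂
    (fun ψ ψ' => ⟨ψ.1.and ψ'.1, by
      obtain ⟨_, φ, hφ, h⟩ := ψ
      obtain ⟨_, φ', hφ', h'⟩ := ψ'
      exact ⟨φ.and φ', ⟨hφ, hφ'⟩, fun X => and_congr (h X) (h' X)⟩⟩)
    (fun _ _ h _ _ h' X => and_congr (h X) (h' X))

/-- Disjunction. -/
def or : OptDomain A → OptDomain A → OptDomain A :=
  Quotient.map₂
    (fun ψ ψ' => ⟨ψ.1.or ψ'.1, by
      obtain ⟨_, φ, hφ, h⟩ := ψ
      obtain ⟨_, φ', hφ', h'⟩ := ψ'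
      exact ⟨φ.or φ', ⟨hφ, hφ'⟩, fun X => or_congr (h X) (h' X)⟩⟩)
    (fun _ _ h _ _ h' X => or_congr (h X) (h' X))

theorem sat_and (X : Set Q) (x y : OptDomain A) : (x.and y).Sat X ↔ x.Sat X ∧ y.Sat X := by
  induction x using Quotient.inductionOn
  induction y using Quotient.inductionOn
  rfl

theorem sat_or (X : Set Q) (x y : OptDomain A) : (x.or y).Sat X ↔ x.Sat X ∨ y.Sat X := by
  induction x using Quotient.inductionOn
  induction y using Quotient.inductionOn
  rfl

/-- The ordering is implication; the meet is conjunction and the join is disjunction. -/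
instance : Lattice (OptDomain A) where
  le x y := ∀ X, x.Sat X → y.Sat X
  le_refl _ _ h := h
  le_trans _ _ _ h h' X hX := h' X (h X hX)
  le_antisymm _ _ h h' := ext_sat fun X => ⟨h X, h' X⟩
  inf := and
  inf_le_left x y X h := ((sat_and X x y).1 h).1
  inf_le_right x y X h := ((sat_and X x y).1 h).2
  le_inf x y z h h' X hX := (sat_and X y z).2 ⟨h X hX, h' X hX⟩
  sup := or
  le_sup_left x y X h := (sat_or X x y).2 (Or.inl h)
  le_sup_right x y X h := (sat_or X x y).2 (Or.inr h)
  sup_le x y z h h' X hX := ((sat_or X x y).1 hX).elim (h X) (h' X)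

/-- The top element is the formula `tru`. -/
instance : OrderTop (OptDomain A) where
  top := Quotient.mk _ ⟨.tru, .tru, trivial, fun _ => Iff.rfl⟩
  le_top _ _ _ := trivial

instance : Finite (OptDomain A) :=
  Finite.of_injective (fun x => {X : Set Q | x.Sat X})
    (fun _ _ h => ext_sat fun X => Set.ext_iff.1 h X)

/-- The interpretation `⋁ Q_f` of the end marker. -/
def final (A : NFA T Q) : OptDomain A :=
  Quotient.mk _ ⟨Formula.bigOr A.accept, .atom ⟨acceptFrom A [], [], rfl⟩, trivial, fun X => by
    have : acceptFrom A [] = A.accept := by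
      ext q
      simp [acceptFrom, NFA.mem_acceptsFrom]
    simp [optAbs, Formula.bind, this]⟩

theorem exists_predec (a : T) (φ : Formula (acceptSets A)) (hφ : φ.IsPositive) :
    ∃ φ' : Formula (acceptSets A), φ'.IsPositive ∧
      ∀ X, ((optAbs φ).bind (fun q => Formula.bigOr (predec A a {q}))).Sat X ↔
        (optAbs φ').Sat X := by
  induction φ with
  | tru => exact ⟨.tru, trivial, fun _ => Iff.rfl⟩
  | fls => exact hφ.elim
  | atom S =>
    obtain ⟨_, x, rfl⟩ := S
    refine ⟨.atom ⟨acceptFrom A (a :: x), a :: x, rfl⟩, trivial, fun X => ?_⟩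
    rw [Formula.sat_bind]
    simp only [optAbs, Formula.bind, Formula.sat_bigOr, ← predec_acceptFrom]
    simp only [predec, Set.mem_ofPred_eq, Set.mem_singleton_iff, exists_eq_left]
    constructor
    · rintro ⟨q, hq, q', h, hX⟩
      exact ⟨q', ⟨q, hq, h⟩, hX⟩
    · rintro ⟨q', ⟨q, hq, h⟩, hX⟩
      exact ⟨q, hq, q', h, hX⟩
  | and φ ψ ih ih' =>
    obtain ⟨φ', h1, h2⟩ := ih hφ.1
    obtain ⟨ψ', h3, h4⟩ := ih' hφ.2
    exact ⟨φ'.and ψ', ⟨h1, h3⟩, fun X => and_congr (h2 X) (h4 X)⟩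
  | or φ ψ ih ih' =>
    obtain ⟨φ', h1, h2⟩ := ih hφ.1
    obtain ⟨ψ', h3, h4⟩ := ih' hφ.2
    exact ⟨φ'.or ψ', ⟨h1, h3⟩, fun X => or_congr (h2 X) (h4 X)⟩

/-- The interpretation of the letter `a`: replace each state `q` by the disjunction of its
`a`-predecessors. -/
def letter (A : NFA T Q) (a : T) : OptDomain A → OptDomain A :=
  Quotient.map
    (fun ψ => ⟨ψ.1.bind (fun q => Formula.bigOr (predec A a {q})), by
      obtain ⟨ψ, φ, hφ, h⟩ := ψ
      obtain ⟨φ', hφ', h'⟩ := exists_predec a φ hφ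
      refine ⟨φ', hφ', fun X => ?_⟩
      rw [← h' X, Formula.sat_bind, Formula.sat_bind]
      exact h _⟩)
    (fun ψ ψ' h X => by
      simp only [Formula.sat_bind]
      exact h _)

theorem letter_monotone (A : NFA T Q) (a : T) : Monotone (letter A a) := by
  intro x y h X
  induction x using Quotient.inductionOn with | _ ψ => ?_
  induction y using Quotient.inductionOn with | _ ψ' => ?_
  intro hX
  refine (Formula.sat_bind _ X ψ'.1).2 (h _ ?_)
  exact (Formula.sat_bind _ X ψ.1).1 hX

end OptDomain

/-- In a finite partial order, the meet of a descending chain is one of its elements. -/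
theorem exists_eq_of_antitone {α : Type u} [PartialOrder α] [Finite α] (d : ℕ → α)
    (hd : Antitone d) : ∃ i, IsGLB (Set.range d) (d i) := by
  obtain ⟨_, ⟨i, rfl⟩, hi⟩ := (Set.toFinite (Set.range d)).exists_minimal ⟨d 0, 0, rfl⟩
  refine ⟨i, ?_, fun z hz => hz ⟨i, rfl⟩⟩
  rintro _ ⟨j, rfl⟩
  exact (hi ⟨max i j, rfl⟩ (hd (le_max_left i j))).trans (hd (le_max_right i j))

theorem meetContinuous_of_monotone {α : Type u} {β : Type v} [PartialOrder α] [Finite α]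
    [PartialOrder β] {f : α → β} (hf : Monotone f) : MeetContinuous f := by
  intro d hd m hm
  obtain ⟨i, hi⟩ := exists_eq_of_antitone d hd
  rw [hm.unique hi]
  refine ⟨?_, fun z hz => hz ⟨i, rfl⟩⟩
  rintro _ ⟨j, rfl⟩
  exact hf (hi.1 ⟨j, rfl⟩)

/-- `OptDomain A` as a cppo. -/
def optCppo [Finite Q] (A : NFA T Q) : Cppo.{w} where
  carrier := OptDomain A
  exists_meet d hd := (exists_eq_of_antitone d hd).imp' d fun _ h => h

/-- Currying: an `n`-ary monotone function on a finite ground domain as an element of the domain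
of the kind `ground → ⋯ → ground`. -/
def curryPower (D : Cppo.{w}) [Finite D] :
    (n : ℕ) → ((Fin n → D) →o D) →o D.dom (Kind.power n)
  | 0 => ⟨fun f => f Fin.elim0, fun _ _ h => h _⟩
  | n + 1 =>
    ⟨fun f => (⟨fun d => curryPower D n ⟨fun x => f (Fin.cons d x), fun _ _ h =>
          f.monotone (Fin.cons_le_cons.2 ⟨le_rfl, h⟩)⟩,
        meetContinuous_of_monotone fun _ _ h => (curryPower D n).monotone fun _ =>
          f.monotone (Fin.cons_le_cons.2 ⟨h, le_rfl⟩)⟩ : ContFun D (D.dom (Kind.power n))),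
      fun _ _ h _ => (curryPower D n).monotone fun _ => h _⟩

/-- Conjunction (for Player `∀`) or disjunction (for Player `∃`) of `n > 0` formulas. -/
def OptDomain.choice [Finite Q] (A : NFA T Q) (n : ℕ) (hn : 0 < n) :
    Player → ((Fin n → OptDomain A) →o OptDomain A)
  | .universal => ⟨fun x => Finset.univ.inf' ⟨⟨0, hn⟩, Finset.mem_univ _⟩ x,
      fun _ _ h => Finset.inf'_mono_fun fun i _ => h i⟩
  | .existential => ⟨fun x => Finset.univ.sup' ⟨⟨0, hn⟩, Finset.mem_univ _⟩ x,
      fun _ _ h => Finset.sup'_mono_fun fun i _ => h i⟩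

end Optimized

namespace Game

variable {T : Type u} {N : Type v} {Q : Type w} [Finite Q]

instance (A : NFA T Q) : Finite (optCppo A) := inferInstanceAs (Finite (OptDomain A))

/-- The optimized model for the determinized scheme of the game. -/
def optModel (g : Game T N Q) : Model.{max u v, w} g.scheme.detKind where
  domain := optCppo g.aut
  interp
    | .inl (.letter a) => (⟨OptDomain.letter g.aut a,
        meetContinuous_of_monotone (OptDomain.letter_monotone g.aut a)⟩ :
        ContFun (OptDomain g.aut) (OptDomain g.aut))
    | .inl .endMarker => OptDomain.final g.aut
    | .inr F => curryPower (optCppo g.aut) (g.scheme.ruleCount F)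
        (OptDomain.choice g.aut _ (g.scheme.ruleCount_pos F) (g.owner F))

/-- The value of the initial symbol in the semantics of the determinized scheme
in the optimized model. -/
def optSolutionStart (g : Game T N Q) : OptDomain g.aut :=
  g.optModel.solutionStart g.scheme.det g.scheme.det_deterministic

end Game

end HORS

end

/-!
Applying a letter `a` to a formula amounts to moving the assignment along the `a`-transitions of
the automaton (`OptDomain.sat_letter`), so the value of `a₁ (⋯ (aₖ t))` is satisfied by `{q₀}` if
and only if the value of `t` is satisfied by the set of states reached from `q₀` by `a₁ ⋯ aₖ`.
In particular, the value of a word is satisfied by `{q₀}` if and only if the word is accepted.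
Positions are evaluated directly, as terms over the terminals of the game; the operators `op F`
only enter through the values of the non-terminals.

If the value of the start symbol is satisfied by `{q₀}`, Player `∃` keeps the value of the position
satisfied. By the fixed point equation and the substitution lemma, the value of a redex is the
disjunction or the conjunction of the values of its reducts (`Game.value_redex`), so Player `∃` can
choose a suitable rule, and no choice of Player `∀` does harm. Infinite plays are won anyway, and a
position without moves is a word, which is then accepted (`Game.existentialWins_of_sat`).

For the converse, call a position lost if Player `∀` can enforce in finitely many moves that the
play ends badly (`Game.Lost`); from such a position no strategy of Player `∃` wins. That a term
with a false value is lost does not follow by counting the unfoldings of non-terminals, since the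
arguments of a redex contain non-terminals that are not unfolded in the same step. Instead, a
logical relation between values and closed terms extends the claim "if the value is false then the
position is lost" to all kinds (`Game.Related`). Each approximant of the greatest fixed point is
related to the non-terminals by induction (`Game.related_approx`), beginning with the greatest
element, which is related to all terms; and the relation is closed under meets of descending chains
since the ground domain is finite (`Game.Related.of_isGLB`).
-/

noncomputable section

namespace HORS

/-! ### Satisfaction in the optimized domain -/

namespace OptDomain

variable {T : Type*} {Q : Type*} [Finite Q] {A : NFA T Q}

/-- Instead of applying a letter to a formula, one can apply the transition function of the
automaton to the assignment. -/
theorem sat_letter (a : T) (X : Set Q) (x : OptDomain A) :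
    (letter A a x).Sat X ↔ x.Sat (A.stepSet X a) := by
  induction x using Quotient.inductionOn with | _ ψ => ?_
  have h : {q | (Formula.bigOr (predec A a {q})).Sat X} = A.stepSet X a := by
    ext q
    simp [Formula.sat_bigOr, predec, NFA.mem_stepSet, and_comm]
  change (ψ.1.bind _).Sat X ↔ ψ.1.Sat _
  rw [Formula.sat_bind, h]

theorem sat_final (X : Set Q) : (final A).Sat X ↔ ∃ q ∈ A.accept, q ∈ X :=
  Formula.sat_bigOr X A.accept

theorem sat_choice_universal {n : ℕ} (hn : 0 < n) (X : Set Q) (x : Fin n → OptDomain A) :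
    (choice A n hn .universal x).Sat X ↔ ∀ i, (x i).Sat X := by
  constructor
  · intro h i
    exact Finset.inf'_le x (Finset.mem_univ i) X h
  · intro h
    exact Finset.inf'_induction (p := fun y : OptDomain A => y.Sat X) ⟨⟨0, hn⟩, Finset.mem_univ _⟩ x
      (fun y hy z hz => (sat_and X y z).2 ⟨hy, hz⟩) (fun i _ => h i)

theorem sat_choice_existential {n : ℕ} (hn : 0 < n) (X : Set Q) (x : Fin n → OptDomain A) :
    (choice A n hn .existential x).Sat X ↔ ∃ i, (x i).Sat X := by
  constructor
  · exact Finset.sup'_induction (p := fun y : OptDomain A => y.Sat X → ∃ i, (x i).Sat X)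
      ⟨⟨0, hn⟩, Finset.mem_univ _⟩ x (fun y hy z hz h => ((sat_or X y z).1 h).elim hy hz) (fun i _ h => ⟨i, h⟩)
  · rintro ⟨i, h⟩
    exact Finset.le_sup' x (Finset.mem_univ i) X h

end OptDomain

/-! ### Closed terms without abstractions -/

namespace Term

variable {T : Type*} {N : Type*} {τ : T → Kind} {η : N → Kind}

theorem LambdaFree.subst {Γ Δ : List Kind} {κ : Kind} {t : Term τ η Γ κ}
    (ht : t.LambdaFree) {s : ∀ κ, Var Γ κ → Term τ η Δ κ}
    (hs : ∀ κ x, (s κ x).LambdaFree) : (t.subst s).LambdaFree := by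
  induction t with
  | terminal => trivial
  | nonterminal => trivial
  | var x => exact hs _ x
  | app t t' ih ih' => exact ⟨ih ht.1 hs, ih' ht.2 hs⟩
  | lam => exact ht.elim

/-- All the terms of the tuple are free of abstractions. -/
def Args.LambdaFree : (κ : Kind) → Args τ η κ → Prop
  | .ground, _ => True
  | .arrow _ κ₂, ts => ts.1.LambdaFree ∧ Args.LambdaFree κ₂ ts.2

theorem LambdaFree.of_applyArgs (κ : Kind) {t : Term τ η [] κ} {ts : Args τ η κ}
    (h : (applyArgs κ t ts).LambdaFree) : t.LambdaFree ∧ ts.LambdaFree κ := by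
  induction κ with
  | ground => exact ⟨h, trivial⟩
  | arrow κ₁ κ₂ _ ih =>
    obtain ⟨h₁, h₂⟩ := ih (ts := ts.2) h
    exact ⟨h₁.1, h₁.2, h₂⟩

theorem lambdaFree_argSub (κ : Kind) {Γ : List Kind} {ts : Args τ η κ} (hts : ts.LambdaFree κ)
    {s : ∀ κ, Var Γ κ → Term τ η [] κ} (hs : ∀ κ x, (s κ x).LambdaFree) :
    ∀ κ' x, (argSub κ ts s κ' x).LambdaFree := by
  induction κ generalizing Γ with
  | ground => exact hs
  | arrow κ₁ κ₂ _ ih =>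
    refine ih hts.2 fun κ' x => ?_
    cases x with
    | zero => exact hts.1
    | succ x => exact hs _ x

theorem LambdaFree.ofKind {Γ : List Kind} {κ κ' : Kind} (h : κ = κ') {t : Term τ η Γ κ}
    (ht : t.LambdaFree) : (ofKind h t).LambdaFree := by
  subst h
  exact ht

/-- The first non-terminal of a term, read from left to right. In a position with a move this is
the head of the redex, so it determines whose turn it is. -/
def firstNonterminal : {Γ : List Kind} → {κ : Kind} → Term τ η Γ κ → Option N
  | _, _, terminal _ => none
  | _, _, nonterminal F => some F
  | _, _, var _ => none
  | _, _, app t t' => t.firstNonterminal.or t'.firstNonterminal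
  | _, _, lam _ => none

theorem firstNonterminal_applyArgs {F : N} (κ : Kind) {t : Term τ η [] κ}
    (h : t.firstNonterminal = some F) (ts : Args τ η κ) :
    (applyArgs κ t ts).firstNonterminal = some F := by
  induction κ with
  | ground => exact h
  | arrow κ₁ κ₂ _ ih => exact ih (by simp [firstNonterminal, h]) ts.2

/-- The non-terminal at the head of the term `t t₁ ⋯ tₙ`, together with all its arguments. This is
a left inverse of `applyArgs`, by which a redex determines its non-terminal and its arguments
without comparing terms of different kinds. -/
def spine : {κ : Kind} → Term τ η [] κ → Args τ η κ → Option (Σ F, Args τ η (η F))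
  | _, nonterminal F, ts => some ⟨F, ts⟩
  | _, app t t', ts => t.spine (t', ts)
  | _, terminal _, _ => none
  | _, var _, _ => none
  | _, lam _, _ => none

theorem spine_terminal (s : T) (ts : Args τ η (τ s)) : (terminal s).spine ts = none := by
  rw [spine]

theorem spine_app {κ κ' : Kind} (t : Term τ η [] (.arrow κ' κ)) (t' : Term τ η [] κ')
    (ts : Args τ η κ) : (app t t').spine ts = t.spine (t', ts) := by
  rw [spine]

theorem spine_applyArgs (κ : Kind) (t : Term τ η [] κ) (ts : Args τ η κ) :
    (applyArgs κ t ts).spine PUnit.unit = t.spine ts := by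
  induction κ with
  | ground => rfl
  | arrow κ₁ κ₂ _ ih => exact (ih (.app t ts.1) ts.2).trans (spine_app t ts.1 ts.2)

end Term

/-- A letter as a word of length one, and the end marker as the empty word. -/
def WordTerminal.toWord {T : Type*} : WordTerminal T → List T
  | letter a => [a]
  | endMarker => []

/-- The letters of a term, read from left to right; a left inverse of `Game.wordTerm`. -/
def Term.letters {T : Type*} {N : Type*} {η : N → Kind} : {Γ : List Kind} → {κ : Kind} →
    Term (WordTerminal.kind (T := T)) η Γ κ → List T
  | _, _, terminal s => s.toWord
  | _, _, nonterminal _ => []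
  | _, _, var _ => []
  | _, _, app t t' => t.letters ++ t'.letters
  | _, _, lam _ => []

/-! ### Positions and moves -/

namespace Game

variable {T : Type*} {N : Type*} {Q : Type*}

/-- The term `a₁ (⋯ (aₖ t))`. -/
def consWord (g : Game T N Q) (x : List T) (t : g.Position) : g.Position :=
  x.foldr g.consLetter t

theorem consWord_append (g : Game T N Q) (x : List T) (a : T) (t : g.Position) :
    g.consWord (x ++ [a]) t = g.consWord x (g.consLetter a t) := by
  simp [consWord]

theorem consWord_endMarker (g : Game T N Q) (x : List T) :
    g.consWord x (.terminal (τ := WordTerminal.kind (T := T)) .endMarker) = g.wordTerm x := by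
  induction x with
  | nil => rfl
  | cons a x ih => exact congrArg (g.consLetter a) ih

theorem letters_wordTerm (g : Game T N Q) (x : List T) : (g.wordTerm x).letters = x := by
  induction x with
  | nil => rfl
  | cons a x ih => exact congrArg (a :: ·) ih

theorem firstNonterminal_wordTerm (g : Game T N Q) (x : List T) :
    (g.wordTerm x).firstNonterminal = none := by
  induction x with
  | nil => rfl
  | cons a x ih => simpa [wordTerm, consLetter, Term.firstNonterminal] using ih

theorem mem_accepts_iff (g : Game T N Q) (x : List T) :
    x ∈ g.aut.accepts ↔ ∃ q ∈ g.aut.accept, q ∈ g.aut.evalFrom {g.init} x := by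
  rw [← g.start_eq]
  rfl

theorem Move.consWord {g : Game T N Q} {p : Player} {t t' : g.Position} (h : g.Move p t t')
    (x : List T) : g.Move p (g.consWord x t) (g.consWord x t') := by
  induction x with
  | nil => exact h
  | cons a x ih => exact ih.letter a

theorem Move.exists_firstNonterminal {g : Game T N Q} {p : Player} {t t' : g.Position}
    (h : g.Move p t t') : ∃ F, t.firstNonterminal = some F ∧ g.owner F = p := by
  induction h with
  | redex F ts i => exact ⟨F, Term.firstNonterminal_applyArgs _ rfl ts, rfl⟩
  | letter a h ih => exact ih

theorem Move.player_unique {g : Game T N Q} {p p' : Player} {t t' t'' : g.Position}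
    (h : g.Move p t t') (h' : g.Move p' t t'') : p = p' := by
  obtain ⟨F, hF, rfl⟩ := h.exists_firstNonterminal
  obtain ⟨F', hF', rfl⟩ := h'.exists_firstNonterminal
  rw [hF, Option.some_inj] at hF'
  rw [hF']

theorem not_step_wordTerm (g : Game T N Q) (x : List T) (t : g.Position) :
    ¬ g.Step (g.wordTerm x) t := by
  rintro ⟨p, h⟩
  obtain ⟨F, hF, -⟩ := h.exists_firstNonterminal
  rw [firstNonterminal_wordTerm] at hF
  cases hF

theorem consLetter_injective {g : Game T N Q} {a b : T} {t u : g.Position}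
    (h : g.consLetter a t = g.consLetter b u) : a = b ∧ t = u := by
  obtain ⟨-, h₁, h₂⟩ := Term.app.inj h
  have h₃ := congrArg Term.letters (eq_of_heq h₁)
  exact ⟨by simpa [Term.letters, WordTerminal.toWord] using h₃, eq_of_heq h₂⟩

theorem consLetter_ne_applyArgs {g : Game T N Q} (a : T) (t : g.Position) (F : N)
    (ts : Term.Args WordTerminal.kind g.kind (g.kind F)) :
    g.consLetter a t ≠ Term.applyArgs (g.kind F) (.nonterminal F) ts := by
  intro h
  have h' := congrArg (fun v : g.Position => v.spine PUnit.unit) h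
  have hnone : Term.spine (κ := .ground) (g.consLetter a t) PUnit.unit = none :=
    (Term.spine_app (κ := .ground) _ _ _).trans
      (Term.spine_terminal (τ := WordTerminal.kind) (.letter a) _)
  simp only [hnone, Term.spine_applyArgs, Term.spine] at h'
  cases h'

/-- The moves from `a₁ (⋯ (aₖ (F t₁ ⋯ tₙ)))` are given by the rules of `F`. -/
theorem Move.exists_rule {g : Game T N Q} {p : Player} {x : List T} {F : N}
    {ts : Term.Args WordTerminal.kind g.kind (g.kind F)} {t : g.Position}
    (h : g.Move p (g.consWord x (Term.applyArgs (g.kind F) (.nonterminal F) ts)) t) :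
    ∃ i, t = g.consWord x (Term.instantiate (g.kind F) (g.scheme.body F i) ts) := by
  induction x generalizing t with
  | nil =>
    generalize hu : g.consWord [] (Term.applyArgs (g.kind F) (.nonterminal F) ts) = u at h
    replace hu : Term.applyArgs (g.kind F) (.nonterminal F) ts = u := hu
    cases h with
    | redex F' ts' i =>
      have h' := congrArg (fun v : g.Position => v.spine PUnit.unit) hu
      simp only [Term.spine_applyArgs, Term.spine, Option.some.injEq] at h'
      cases h'
      exact ⟨i, rfl⟩
    | letter a h => exact (consLetter_ne_applyArgs _ _ _ _ hu.symm).elim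
  | cons a x ih =>
    generalize hu : g.consWord (a :: x) (Term.applyArgs (g.kind F) (.nonterminal F) ts) = u at h
    cases h with
    | redex F' ts' i => exact (consLetter_ne_applyArgs _ _ _ _ hu).elim
    | letter b h =>
      obtain ⟨rfl, rfl⟩ := consLetter_injective hu
      obtain ⟨i, rfl⟩ := ih h
      exact ⟨i, rfl⟩

theorem Move.lambdaFree {g : Game T N Q} {p : Player} {t t' : g.Position} (h : g.Move p t t')
    (ht : t.LambdaFree) : t'.LambdaFree := by
  induction h with
  | redex F ts i =>
    exact (g.scheme.body_lambdaFree F i).subst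
      (Term.lambdaFree_argSub _ (Term.LambdaFree.of_applyArgs _ ht).2 fun _ x => x.elim)
  | letter a h ih => exact ⟨trivial, ih ht.2⟩

/-- Case distinction on the head of a fully applied term. The arguments are generalized, so that
the term at the head can be decomposed by structural recursion. -/
theorem applyArgs_cases (g : Game T N Q) : {κ : Kind} →
    (t : Term (WordTerminal.kind (T := T)) g.kind [] κ) → t.LambdaFree →
    (ts : Term.Args WordTerminal.kind g.kind κ) →
    Term.applyArgs κ t ts = g.wordTerm [] ∨
      (∃ a u, Term.applyArgs κ t ts = g.consLetter a u) ∨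
      ∃ F ts', Term.applyArgs κ t ts = Term.applyArgs (g.kind F) (.nonterminal F) ts'
  | _, .terminal (.letter a), _, ts => Or.inr (Or.inl ⟨a, ts.1, rfl⟩)
  | _, .terminal .endMarker, _, _ => Or.inl rfl
  | _, .nonterminal F, _, ts => Or.inr (Or.inr ⟨F, ts, rfl⟩)
  | _, .var x, _, _ => x.elim
  | _, .app t t', ht, ts => g.applyArgs_cases t ht.1 (t', ts)
  | _, .lam _, ht, _ => ht.elim

/-- A position without abstractions is a word, or there is a move. -/
theorem eq_wordTerm_or_step (g : Game T N Q) (t : g.Position) (ht : t.LambdaFree) :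
    (∃ x, t = g.wordTerm x) ∨ ∃ t', g.Step t t' := by
  induction hn : sizeOf t using Nat.strong_induction_on generalizing t with
  | _ n ih =>
    obtain h | ⟨a, u, h⟩ | ⟨F, ts, h⟩ := g.applyArgs_cases t ht PUnit.unit
    · exact Or.inl ⟨[], h⟩
    · replace h : t = g.consLetter a u := h
      subst h
      obtain ⟨x, rfl⟩ | ⟨u', p, hu⟩ := ih (sizeOf u) (by simp [← hn, consLetter]) u ht.2 rfl
      · exact Or.inl ⟨a :: x, rfl⟩
      · exact Or.inr ⟨_, p, hu.letter a⟩
    · replace h : t = _ := h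
      subst h
      exact Or.inr ⟨_, _, .redex F ts ⟨0, g.scheme.ruleCount_pos F⟩⟩

/-! ### Strategies -/

/-- A set of positions that contains the start position, that Player `∀` cannot leave, in which
Player `∃` can always stay at her turns, and whose positions without moves are accepted words,
yields a winning strategy. -/
theorem existentialWins_of_invariant (g : Game T N Q) (I : g.Position → Prop)
    (hstart : I g.scheme.startTerm)
    (huniv : ∀ t t', I t → g.Move .universal t t' → I t')
    (hex : ∀ t, I t → g.Turn .existential t → ∃ t', g.Move .existential t t' ∧ I t')
    (hstuck : ∀ t, I t → (∀ t', ¬ g.Step t t') → ∃ x ∈ g.aut.accepts, t = g.wordTerm x) :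
    g.ExistentialWins := by
  -- A positional strategy: stay in `I` where possible. A move is needed in positions outside `I`
  -- as well, since a strategy has to be defined on all histories.
  have hmove : ∀ t, ∃ t', g.Turn .existential t → g.Move .existential t t' ∧ (I t → I t') := by
    intro t
    by_cases hT : g.Turn .existential t
    · by_cases hI : I t
      · obtain ⟨t', h, h'⟩ := hex t hI hT
        exact ⟨t', fun _ => ⟨h, fun _ => h'⟩⟩
      · obtain ⟨t', h⟩ := hT
        exact ⟨t', fun _ => ⟨h, fun h' => (hI h').elim⟩⟩
    · exact ⟨t, fun h => (hT h).elim⟩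
  choose m hm using hmove
  have key : ∀ l : List g.Position, g.IsHistory l →
      (∀ (l₁ l₂ : List g.Position) (t t' : g.Position), l = l₁ ++ t :: t' :: l₂ →
        g.Turn .existential t → t' = m t) → ∀ t ∈ l.getLast?, I t := by
    intro l
    induction l using List.reverseRecOn with
    | nil => simp
    | append_singleton l t' ih =>
      intro hl hc u hu
      obtain rfl : t' = u := by simpa using hu
      obtain rfl | ⟨l, t, rfl⟩ := l.eq_nil_or_concat'
      · obtain rfl : t' = g.scheme.startTerm := by simpa using hl.1
        exact hstart
      · have hchain := hl.2
        rw [List.append_assoc, List.singleton_append, List.isChain_append_cons_cons] at hchain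
        have ht : I t := by
          refine ih ⟨?_, hl.2.left_of_append⟩ (fun l₁ l₂ u u' h => ?_) t (by simp)
          · simpa [List.head?_append] using hl.1
          · exact hc l₁ (l₂ ++ [t']) u u' (by simp [h])
        obtain ⟨p, hp⟩ := hchain.2.1
        cases p with
        | existential =>
          rw [hc l [] t t' (by simp) ⟨t', hp⟩]
          exact (hm t ⟨t', hp⟩).2 ht
        | universal => exact huniv t t' ht hp
  refine ⟨fun l => m (l.getLast?.getD g.scheme.startTerm), fun l t _ hT => ?_, fun π hπ hc => ?_⟩
  · simpa using (hm t hT).1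
  · cases π with
    | infinite f => trivial
    | finite l =>
      obtain ⟨hl, hend⟩ := hπ
      have hl0 : l ≠ [] := by
        rintro rfl
        simpa using hl.1
      have hlast := List.getLast?_eq_some_getLast hl0
      obtain ⟨x, hx, h⟩ := hstuck _ (key l hl (fun l₁ l₂ t t' h hT => by
        simpa using hc l₁ l₂ t t' h hT) _ hlast) (hend _ hlast)
      exact ⟨x, hx, by rw [hlast, h]⟩

/-- The positions from which Player `∀` can enforce that the play ends, after finitely many
moves, in a position that is not a word of the language. -/
inductive Lost (g : Game T N Q) : g.Position → Prop
  | stuck {t : g.Position} (h : ∀ t', ¬ g.Step t t') (h' : ∀ x ∈ g.aut.accepts, t ≠ g.wordTerm x) :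
      Lost g t
  | existential {t : g.Position} (h : g.Turn .existential t)
      (h' : ∀ t', g.Move .existential t t' → Lost g t') : Lost g t
  | universal {t t' : g.Position} (h : g.Move .universal t t') (h' : Lost g t') : Lost g t

/-- Every history that conforms to a strategy of Player `∃` and ends in a lost position can be
extended to a conforming play that Player `∃` does not win. -/
theorem Lost.exists_play {g : Game T N Q} {s : List g.Position → g.Position}
    (hs : g.IsStrategy s) {t : g.Position} (ht : g.Lost t) (l : List g.Position)
    (hl : g.IsHistory (l ++ [t])) (hc : g.Conforms s (.finite (l ++ [t]))) :
    ∃ π, g.IsMaximalPlay π ∧ g.Conforms s π ∧ ¬ g.WonByExistential π := by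
  have hextend : ∀ (l : List g.Position) (t t' : g.Position), g.IsHistory (l ++ [t]) →
      g.Conforms s (.finite (l ++ [t])) → g.Step t t' →
      (g.Turn .existential t → t' = s (l ++ [t])) →
      g.IsHistory ((l ++ [t]) ++ [t']) ∧ g.Conforms s (.finite ((l ++ [t]) ++ [t'])) := by
    intro l t t' hl hc hstep ht'
    refine ⟨⟨?_, ?_⟩, fun l₁ l₂ u u' h hu => ?_⟩
    · rw [List.head?_append, hl.1, Option.some_or]
    · refine hl.2.append (List.isChain_singleton _) ?_
      simpa using hstep
    · -- Either the pair `u`, `u'` is the new last step, or it belongs to the old history.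
      obtain rfl | ⟨l₂, v, rfl⟩ := l₂.eq_nil_or_concat'
      · have h' : (l ++ [t]) ++ [t'] = (l₁ ++ [u]) ++ [u'] := by simpa using h
        obtain ⟨h₁, h₂⟩ := List.append_inj' h' rfl
        obtain ⟨rfl, h₃⟩ := List.append_inj' h₁ rfl
        simp only [List.cons.injEq, and_true] at h₂ h₃
        subst h₂ h₃
        exact ht' hu
      · have h' : (l ++ [t]) ++ [t'] = (l₁ ++ u :: u' :: l₂) ++ [v] := by simpa using h
        exact hc l₁ l₂ u u' (List.append_inj' h' rfl).1 hu
  induction ht generalizing l with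
  | @stuck t h h' =>
    refine ⟨.finite (l ++ [t]), ⟨hl, by simpa using h⟩, hc, ?_⟩
    rintro ⟨x, hx, hlast⟩
    exact h' x hx (by simpa using hlast)
  | @existential t h _ ih =>
    have hmove := hs l t hl h
    obtain ⟨hl', hc'⟩ := hextend l t _ hl hc ⟨_, hmove⟩ fun _ => rfl
    exact ih _ hmove _ hl' hc'
  | @universal t t' h _ ih =>
    obtain ⟨hl', hc'⟩ := hextend l t t' hl hc ⟨_, h⟩ fun ⟨_, h'⟩ => by cases h.player_unique h'
    exact ih _ hl' hc'

theorem Lost.not_existentialWins {g : Game T N Q} (h : g.Lost g.scheme.startTerm) :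
    ¬ g.ExistentialWins := by
  rintro ⟨s, hs, hwin⟩
  obtain ⟨π, hπ, hc, hlose⟩ := h.exists_play hs [] ⟨rfl, List.isChain_singleton _⟩ (by
    intro l₁ l₂ t t' h
    have := congrArg List.length h
    simp at this
    omega)
  exact hlose (hwin π hπ hc)

end Game

/-! ### The greatest fixed point -/

namespace Model

variable {T : Type*} {N : Type*} {τ : T → Kind} {η : N → Kind}

theorem isGLB_solution (M : Model τ) (G : Scheme τ η) (hG : G.Deterministic) (F : N) :
    IsGLB (Set.range fun i => M.approx G hG i F) (M.solution G hG F) :=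
  ((M.domain.dom (η F)).exists_meet _ (M.approx_antitone G hG F)).choose_spec

theorem approx_succ (M : Model τ) (G : Scheme τ η) (hG : G.Deterministic) (i : ℕ) :
    M.approx G hG (i + 1) = M.rhsFun G hG (M.approx G hG i) :=
  Function.iterate_succ_apply' _ _ _

theorem rhsFun_solution (M : Model τ) (G : Scheme τ η) (hG : G.Deterministic) :
    M.rhsFun G hG (M.solution G hG) = M.solution G hG := by
  funext F
  -- By continuity, the left-hand side is the meet of the chain of approximants without its first
  -- element.
  have h : IsGLB (Set.range fun i => M.approx G hG (i + 1) F)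
      (M.rhsFun G hG (M.solution G hG) F) := by
    simp only [approx_succ]
    refine (M.sem (G.rhs hG F)).cont (fun i => (M.approx G hG i, fun _ x => x.elim))
      (fun i j hij => ⟨fun F => M.approx_antitone G hG F hij, fun _ x => x.elim⟩) _
      (Valuation.isGLB_iff.2 ⟨M.isGLB_solution G hG, fun _ x => x.elim⟩)
  refine h.unique ⟨?_, fun z hz => (M.isGLB_solution G hG F).2 ?_⟩
  · rintro _ ⟨i, rfl⟩
    exact (M.isGLB_solution G hG F).1 ⟨i + 1, rfl⟩
  · rintro _ ⟨i, rfl⟩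
    exact (hz ⟨i, rfl⟩).trans (M.approx_antitone G hG F i.le_succ)

/-- If `t` denotes the value `f` of the terminal of kind `ground → ⋯ → ground`, then
`t e₁ ⋯ eₙ` denotes `f` applied to the values of the arguments. -/
theorem sem_applyPower (M : Model τ) [Finite M.domain] {Γ : List Kind} (n : ℕ)
    (t : Term τ η Γ (Kind.power n)) (e : Fin n → Term τ η Γ .ground)
    (f : (Fin n → M.domain) →o M.domain) (ν : Valuation M.domain η Γ)
    (h : M.sem t ν = curryPower M.domain n f) :
    M.sem (Term.applyPower n t e) ν = f (fun i => M.sem (e i) ν) := by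
  induction n with
  | zero =>
    refine h.trans ?_
    exact congrArg f (Subsingleton.elim _ _)
  | succ n ih =>
    refine (ih _ _ ⟨fun x => f (Fin.cons (M.sem (e 0) ν) x), fun _ _ h =>
      f.monotone (Fin.cons_le_cons.2 ⟨le_rfl, h⟩)⟩ ?_).trans ?_
    · change ContFun.toFun (α := M.domain) (β := M.domain.dom (Kind.power n)) (M.sem t ν) _ = _
      rw [h]
      rfl
    · refine congrArg f (funext fun i => ?_)
      cases i using Fin.cases <;> rfl

end Model

namespace Game

variable {T : Type*} {N : Type*} {Q : Type*} [Finite Q]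

/-! ### Values of terms of the game -/

/-- The value of a term of the game in the optimized model. Terms of the game do not contain the
operators `op F`, so they are first embedded into the terms of the determinized scheme. -/
def eval (g : Game T N Q) {Γ : List Kind} {κ : Kind}
    (t : Term (WordTerminal.kind (T := T)) g.kind Γ κ) (ν : ∀ F, (optCppo g.aut).dom (g.kind F))
    (ρ : ∀ κ, Var Γ κ → (optCppo g.aut).dom κ) : (optCppo g.aut).dom κ :=
  g.optModel.sem t.addTerminals (ν, ρ)

/-- The right-hand side of `F` in the determinized scheme, without the abstractions. -/
def detBody (g : Game T N Q) (F : N) :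
    Term g.scheme.detKind g.kind ((g.kind F).binders []) .ground :=
  Term.applyPower (g.scheme.ruleCount F) (Term.terminal (τ := g.scheme.detKind) (Sum.inr F))
    (fun i => (g.scheme.body F i).addTerminals)

theorem sem_detBody (g : Game T N Q) (F : N) (ν : ∀ F, (optCppo g.aut).dom (g.kind F))
    (ρ : ∀ κ, Var ((g.kind F).binders []) κ → (optCppo g.aut).dom κ) :
    g.optModel.sem (g.detBody F) (ν, ρ) =
      OptDomain.choice g.aut _ (g.scheme.ruleCount_pos F) (g.owner F)
        (fun i => g.eval (g.scheme.body F i) ν ρ) :=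
  haveI : Finite g.optModel.domain := inferInstanceAs (Finite (OptDomain g.aut))
  g.optModel.sem_applyPower _ _ _ _ (ν, ρ) rfl

/-! ### Player `∃` keeps the value of the position true -/

/-- The value of a closed term under the greatest fixed point. -/
def value (g : Game T N Q) {κ : Kind} (t : Term (WordTerminal.kind (T := T)) g.kind [] κ) :
    (optCppo g.aut).dom κ :=
  g.eval t (g.optModel.solution g.scheme.det g.scheme.det_deterministic) (fun _ x => x.elim)

/-- The substitution lemma, for terms without abstractions. -/
theorem value_subst (g : Game T N Q) {Γ : List Kind} {κ : Kind}
    (t : Term (WordTerminal.kind (T := T)) g.kind Γ κ) (ht : t.LambdaFree)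
    (s : ∀ κ, Var Γ κ → Term (WordTerminal.kind (T := T)) g.kind [] κ) :
    g.value (t.subst s) = g.eval t
      (g.optModel.solution g.scheme.det g.scheme.det_deterministic)
      (fun κ x => g.value (s κ x)) := by
  induction t with
  | terminal => rfl
  | nonterminal => rfl
  | var => rfl
  | @app Γ κ₁ κ₂ t t' ih ih' =>
    change ContFun.toFun (α := (optCppo g.aut).dom κ₁) (β := (optCppo g.aut).dom κ₂)
      (g.value (t.subst s)) (g.value (t'.subst s)) = _
    rw [ih ht.1, ih' ht.2]
    rfl
  | lam => exact ht.elim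

/-- If `t` has the same value as `λ x₁. ⋯ λ xₙ. e`, then `t t₁ ⋯ tₙ` has the value of `e` where
`xᵢ` is evaluated to the value of `tᵢ`. -/
theorem value_applyArgs (g : Game T N Q) (κ : Kind) {Γ : List Kind}
    (e : Term g.scheme.detKind g.kind (κ.binders Γ) .ground)
    (s : ∀ κ, Var Γ κ → Term (WordTerminal.kind (T := T)) g.kind [] κ)
    (t : Term (WordTerminal.kind (T := T)) g.kind [] κ)
    (h : g.value t = g.optModel.sem (Term.lams κ e)
      (g.optModel.solution g.scheme.det g.scheme.det_deterministic, fun κ x => g.value (s κ x)))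
    (ts : Term.Args WordTerminal.kind g.kind κ) :
    g.value (Term.applyArgs κ t ts) = g.optModel.sem e
      (g.optModel.solution g.scheme.det g.scheme.det_deterministic,
        fun κ' x => g.value (Term.argSub κ ts s κ' x)) := by
  induction κ generalizing Γ with
  | ground => exact h
  | arrow κ₁ κ₂ _ ih =>
    refine ih e (Term.consSub ts.1 s) (.app t ts.1) ?_ ts.2
    have hρ : (fun κ x => g.value (Term.consSub ts.1 s κ x)) =
        extendVar (fun κ x => g.value (s κ x)) (g.value ts.1) := by
      funext κ x
      cases x <;> rfl
    rw [hρ]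
    change ContFun.toFun (α := (optCppo g.aut).dom κ₁) (β := (optCppo g.aut).dom κ₂)
      (g.value t) (g.value ts.1) = _
    rw [h]
    rfl

/-- The value of a redex is the conjunction or the disjunction of the values of its reducts. -/
theorem value_redex (g : Game T N Q) (F : N)
    (ts : Term.Args WordTerminal.kind g.kind (g.kind F)) :
    g.value (Term.applyArgs (g.kind F) (.nonterminal F) ts) =
      OptDomain.choice g.aut _ (g.scheme.ruleCount_pos F) (g.owner F)
        (fun i => g.value (Term.instantiate (g.kind F) (g.scheme.body F i) ts)) := by
  have hρ : (fun κ (x : Var [] κ) =>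
        g.value (x.elim : Term (WordTerminal.kind (T := T)) g.kind [] κ)) =
      fun κ (x : Var [] κ) => (x.elim : (optCppo g.aut).dom κ) := by
    funext κ x
    exact x.elim
  refine (g.value_applyArgs (g.kind F) (g.detBody F) (fun _ x => x.elim) _ ?_ ts).trans
    ((g.sem_detBody F _ _).trans ?_)
  · rw [hρ]
    exact (congrFun (g.optModel.rhsFun_solution g.scheme.det g.scheme.det_deterministic) F).symm
  · refine congrArg _ (funext fun i => ?_)
    exact (g.value_subst _ (g.scheme.body_lambdaFree F i) _).symm

theorem sat_value_consLetter (g : Game T N Q) (a : T) (t : g.Position) (X : Set Q) :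
    OptDomain.Sat (A := g.aut) X (g.value (g.consLetter a t)) ↔
      OptDomain.Sat (A := g.aut) (g.aut.stepSet X a) (g.value t) :=
  OptDomain.sat_letter a X (g.value t)

theorem sat_value_wordTerm (g : Game T N Q) (x : List T) (X : Set Q) :
    OptDomain.Sat (A := g.aut) X (g.value (g.wordTerm x)) ↔
      ∃ q ∈ g.aut.accept, q ∈ g.aut.evalFrom X x := by
  induction x generalizing X with
  | nil => exact OptDomain.sat_final X
  | cons a x ih =>
    rw [NFA.evalFrom_cons, ← ih]
    exact g.sat_value_consLetter a _ X

theorem Move.sat_value_of_universal {g : Game T N Q} {p : Player} {t t' : g.Position}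
    (h : g.Move p t t') (hp : p = .universal) (X : Set Q)
    (ht : OptDomain.Sat (A := g.aut) X (g.value t)) :
    OptDomain.Sat (A := g.aut) X (g.value t') := by
  induction h generalizing X with
  | redex F ts i =>
    rw [value_redex, hp] at ht
    exact (OptDomain.sat_choice_universal _ X _).1 ht i
  | letter a h ih =>
    rw [sat_value_consLetter] at ht ⊢
    exact ih hp _ ht

theorem Move.exists_sat_value {g : Game T N Q} {p : Player} {t t' : g.Position}
    (h : g.Move p t t') (hp : p = .existential) (X : Set Q)
    (ht : OptDomain.Sat (A := g.aut) X (g.value t)) :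
    ∃ t'', g.Move p t t'' ∧ OptDomain.Sat (A := g.aut) X (g.value t'') := by
  induction h generalizing X with
  | redex F ts i =>
    rw [value_redex, hp] at ht
    obtain ⟨j, hj⟩ := (OptDomain.sat_choice_existential _ X _).1 ht
    exact ⟨_, .redex F ts j, hj⟩
  | letter a h ih =>
    rw [sat_value_consLetter] at ht
    obtain ⟨t'', h₁, h₂⟩ := ih hp _ ht
    exact ⟨_, h₁.letter a, (g.sat_value_consLetter a t'' X).2 h₂⟩

theorem existentialWins_of_sat (g : Game T N Q)
    (h : OptDomain.Sat (A := g.aut) {g.init} (g.value g.scheme.startTerm)) :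
    g.ExistentialWins := by
  refine g.existentialWins_of_invariant
    (fun t => t.LambdaFree ∧ OptDomain.Sat (A := g.aut) {g.init} (g.value t)) ⟨?_, h⟩ ?_ ?_ ?_
  · exact Term.LambdaFree.ofKind _ trivial
  · rintro t t' ⟨h₁, h₂⟩ h
    exact ⟨h.lambdaFree h₁, h.sat_value_of_universal rfl _ h₂⟩
  · rintro t ⟨h₁, h₂⟩ ⟨t', h⟩
    obtain ⟨t'', h', h''⟩ := h.exists_sat_value rfl _ h₂
    exact ⟨t'', h', h'.lambdaFree h₁, h''⟩
  · rintro t ⟨h₁, h₂⟩ h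
    obtain ⟨x, rfl⟩ | ⟨t', h'⟩ := g.eq_wordTerm_or_step t h₁
    · exact ⟨x, (g.mem_accepts_iff x).2 ((g.sat_value_wordTerm x _).1 h₂), rfl⟩
    · exact (h t' h').elim

/-! ### Player `∀` wins if the value of the start symbol is false -/

/-- The logical relation between values and closed terms. At the ground kind it says that
the term is lost, below every word, unless the value is true in the set of states which
the automaton reaches after reading the word. -/
def Related (g : Game T N Q) : (κ : Kind) → (optCppo g.aut).dom κ →
    Term (WordTerminal.kind (T := T)) g.kind [] κ → Prop
  | .ground, d, t => ∀ x, ¬ OptDomain.Sat (A := g.aut) (g.aut.evalFrom {g.init} x) d →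
      g.Lost (g.consWord x t)
  | .arrow κ₁ κ₂, f, t => ∀ d u, Related g κ₁ d u →
      Related g κ₂ (ContFun.toFun (α := (optCppo g.aut).dom κ₁) (β := (optCppo g.aut).dom κ₂) f d)
        (.app t u)

theorem related_top (g : Game T N Q) (κ : Kind)
    (t : Term (WordTerminal.kind (T := T)) g.kind [] κ) : g.Related κ ⊤ t := by
  induction κ with
  | ground => exact fun x h => (h trivial).elim
  | arrow κ₁ κ₂ _ ih => exact fun d u _ => ih (.app t u)

/-- At the ground kind the meet of the chain is one of its elements, since the domain is finite;
at function kinds meets are computed pointwise. -/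
theorem Related.of_isGLB {g : Game T N Q} {κ : Kind}
    {t : Term (WordTerminal.kind (T := T)) g.kind [] κ} {d : ℕ → (optCppo g.aut).dom κ}
    (hd : Antitone d) {m : (optCppo g.aut).dom κ} (hm : IsGLB (Set.range d) m)
    (h : ∀ i, g.Related κ (d i) t) : g.Related κ m t := by
  induction κ with
  | ground =>
    obtain ⟨i, hi⟩ := exists_eq_of_antitone (α := OptDomain g.aut) d hd
    rw [hm.unique hi]
    exact h i
  | arrow κ₁ κ₂ _ ih =>
    exact fun e u he => ih (fun i j hij => hd hij e)
      (ContFun.isGLB_apply (D := (optCppo g.aut).dom κ₂) hd hm e) fun i => h i e u he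

theorem related_terminal (g : Game T N Q) (s : WordTerminal T) :
    g.Related s.kind (g.optModel.interp (Sum.inl s)) (.terminal s) := by
  cases s with
  | letter a =>
    intro d u hdu x hx
    -- The letter moves from the argument to the word above it.
    have := hdu (x ++ [a])
    rw [NFA.evalFrom_append, NFA.evalFrom_singleton, consWord_append] at this
    exact this fun h => hx ((OptDomain.sat_letter a _ d).2 h)
  | endMarker =>
    intro x hx
    rw [consWord_endMarker]
    refine .stuck (g.not_step_wordTerm x) fun y hy h => hx ?_
    have hxy := congrArg Term.letters h
    rw [letters_wordTerm, letters_wordTerm] at hxy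
    subst hxy
    exact (OptDomain.sat_final _).2 ((g.mem_accepts_iff x).1 hy)

/-- A term without abstractions is related to its value, if this holds for its non-terminals
and variables. -/
theorem related_subst (g : Game T N Q) {Γ : List Kind} {κ : Kind}
    (t : Term (WordTerminal.kind (T := T)) g.kind Γ κ) (ht : t.LambdaFree)
    {ν : ∀ F, (optCppo g.aut).dom (g.kind F)}
    (hν : ∀ F, g.Related (g.kind F) (ν F) (.nonterminal F))
    {ρ : ∀ κ, Var Γ κ → (optCppo g.aut).dom κ}
    {s : ∀ κ, Var Γ κ → Term (WordTerminal.kind (T := T)) g.kind [] κ}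
    (hρ : ∀ κ x, g.Related κ (ρ κ x) (s κ x)) :
    g.Related κ (g.eval t ν ρ) (t.subst s) := by
  induction t with
  | terminal a => exact g.related_terminal a
  | nonterminal F => exact hν F
  | var x => exact hρ _ x
  | app t t' ih ih' => exact ih ht.1 hρ _ _ (ih' ht.2 hρ)
  | lam => exact ht.elim

/-- Relatedness of `λ x₁. ⋯ λ xₙ. e` to a term `t` reduces to the ground kind, by applying both to
related arguments. -/
theorem related_lams (g : Game T N Q) (κ : Kind) {Γ : List Kind}
    (e : Term g.scheme.detKind g.kind (κ.binders Γ) .ground)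
    (ν : ∀ F, (optCppo g.aut).dom (g.kind F))
    {ρ : ∀ κ, Var Γ κ → (optCppo g.aut).dom κ}
    {s : ∀ κ, Var Γ κ → Term (WordTerminal.kind (T := T)) g.kind [] κ}
    (hρ : ∀ κ x, g.Related κ (ρ κ x) (s κ x))
    (t : Term (WordTerminal.kind (T := T)) g.kind [] κ)
    (h : ∀ (ts : Term.Args WordTerminal.kind g.kind κ)
      (ρ' : ∀ κ', Var (κ.binders Γ) κ' → (optCppo g.aut).dom κ'),
      (∀ κ' x, g.Related κ' (ρ' κ' x) (Term.argSub κ ts s κ' x)) →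
      g.Related .ground (g.optModel.sem e (ν, ρ')) (Term.applyArgs κ t ts)) :
    g.Related κ (g.optModel.sem (Term.lams κ e) (ν, ρ)) t := by
  induction κ generalizing Γ with
  | ground => exact h PUnit.unit ρ hρ
  | arrow κ₁ κ₂ _ ih =>
    intro d u hdu
    refine ih e (ρ := extendVar ρ d) (s := Term.consSub u s) (fun κ x => ?_) (.app t u)
      fun ts => h (u, ts)
    cases x with
    | zero => exact hdu
    | succ x => exact hρ _ x

/-- A redex is related to the choice of its owner between values that are related to the reducts:
if the choice is false, then Player `∀` moves to a lost reduct, or all moves of Player `∃` lead to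
lost reducts. -/
theorem related_redex (g : Game T N Q) (F : N)
    (ts : Term.Args WordTerminal.kind g.kind (g.kind F))
    (d : Fin (g.scheme.ruleCount F) → OptDomain g.aut)
    (h : ∀ i, g.Related .ground (d i) (Term.instantiate (g.kind F) (g.scheme.body F i) ts)) :
    g.Related .ground (OptDomain.choice g.aut _ (g.scheme.ruleCount_pos F) (g.owner F) d)
      (Term.applyArgs (g.kind F) (.nonterminal F) ts) := by
  intro x hx
  have hmove := fun i => (Move.redex (g := g) F ts i).consWord x
  cases hF : g.owner F with
  | universal =>
    simp only [hF] at hx hmove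
    rw [OptDomain.sat_choice_universal, not_forall] at hx
    obtain ⟨i, hi⟩ := hx
    exact .universal (hmove i) (h i x hi)
  | existential =>
    simp only [hF] at hx hmove
    rw [OptDomain.sat_choice_existential, not_exists] at hx
    refine .existential ⟨_, hmove ⟨0, g.scheme.ruleCount_pos F⟩⟩ fun t' ht' => ?_
    obtain ⟨i, rfl⟩ := ht'.exists_rule
    exact h i x (hx i)

theorem related_approx (g : Game T N Q) (n : ℕ) (F : N) :
    g.Related (g.kind F)
      (g.optModel.approx g.scheme.det g.scheme.det_deterministic n F) (.nonterminal F) := by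
  induction n generalizing F with
  | zero => exact g.related_top _ _
  | succ n ih =>
    rw [Model.approx_succ]
    refine g.related_lams _ _ _ (s := fun _ x => x.elim) (fun _ x => x.elim) _ fun ts ρ hρ => ?_
    have h := g.related_redex F ts _ fun i => g.related_subst _ (g.scheme.body_lambdaFree F i) ih hρ
    exact Eq.mpr (congrArg (fun d => g.Related .ground d _) (g.sem_detBody F _ ρ)) h

theorem related_solution (g : Game T N Q) (F : N) :
    g.Related (g.kind F)
      (g.optModel.solution g.scheme.det g.scheme.det_deterministic F) (.nonterminal F) :=
  .of_isGLB (g.optModel.approx_antitone g.scheme.det g.scheme.det_deterministic F)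
    (g.optModel.isGLB_solution g.scheme.det g.scheme.det_deterministic F)
    fun n => g.related_approx n F

theorem value_ofKind (g : Game T N Q) {κ κ' : Kind} (h : κ = κ')
    (t : Term (WordTerminal.kind (T := T)) g.kind [] κ) :
    g.value (t.ofKind h) = cast (congrArg (fun κ => ((optCppo g.aut).dom κ : Type _)) h)
      (g.value t) := by
  subst h
  rfl

theorem Related.ofKind {g : Game T N Q} {κ κ' : Kind} (h : κ = κ')
    {t : Term (WordTerminal.kind (T := T)) g.kind [] κ} (ht : g.Related κ (g.value t) t) :
    g.Related κ' (g.value (t.ofKind h)) (t.ofKind h) := by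
  subst h
  exact ht

theorem lost_of_not_sat (g : Game T N Q)
    (h : ¬ OptDomain.Sat (A := g.aut) {g.init} (g.value g.scheme.startTerm)) :
    g.Lost g.scheme.startTerm :=
  -- The relation at the empty word, from which the automaton reaches the set `{q₀}`.
  Related.ofKind g.scheme.start_kind (g.related_solution g.scheme.start) [] h

theorem optSolutionStart_eq_value (g : Game T N Q) :
    g.optSolutionStart = g.value g.scheme.startTerm :=
  (g.value_ofKind g.scheme.start_kind (.nonterminal g.scheme.start)).symm

end Game

end HORS

end

theorem mainTheorem2 {T : Type*} {N : Type*} {Q : Type*} [Finite T] [Finite N] [Finite Q]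
    (g : HORS.Game T N Q) :
    g.optSolutionStart.Sat {g.init} ↔ g.ExistentialWins := by
  rw [g.optSolutionStart_eq_value]
  refine ⟨g.existentialWins_of_sat, fun hwin => ?_⟩
  by_contra h
  exact (g.lost_of_not_sat h).not_existentialWins hwin
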